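/- Let $q$ be an odd prime power, let $\mathbb{F}_q$ be a finite field of order $q$, and let $\mathrm{PSL}_2(q)=\mathrm{SL}_2(\mathbb{F}_q)/Z(\mathrm{SL}_2(\mathbb{F}_q))$. Let $\mathbb{Z}_2$ be the cyclic group of order $2$, regarded as a $\mathrm{PSL}_2(q)$-module with trivial action. Then the second cohomology group satisfies $$H^2(\mathrm{PSL}_2(q),\mathbb{Z}_2)\cong\mathbb{Z}_2.$$ -/

import Mathlib

open scoped MatrixGroups

/-! ### Involutions, transfer of sign, and lifts of dihedral subgroups -/

section GroupTheory

/-! Classes in `H²` are central extensions `E` of `G = PSL₂(q)` by `ZMod 2`. All involutions of `G`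
are conjugate, so in a given `E` either all of them lift to involutions or none does. The cocycle
form of this alternative is the additive invariant `f (c, c) + f (1, 1)`, with `c` a fixed
involution. It takes the value 1 on `SL₂(q)`, where `c` lifts to a square root of `-1`. The
invariant is also injective. Suppose involutions lift to involutions. The centralizer `D` of `c` is
dihedral, and its index is odd because it counts the involutions of `G`. Then `D` lifts to some `L ≤
E` that misses the central involution `z` (`exists_subgroup_index_eq_of_dihedral`). So `z` moves
every point of `E ⧸ L`, a set of size twice an odd number, and is an odd permutation. The sign is a
character of `E` nontrivial on `z`, and it splits the extension. -/

/-- A central involution avoiding a subgroup of index twice an odd number acts as an odd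
permutation on the cosets. -/
theorem exists_monoidHom_units_int_eq_neg_one {E : Type*} [Group E] {z : E}
    (hz : z ∈ Subgroup.center E) (hz2 : z ^ 2 = 1) (L : Subgroup E) (hzL : z ∉ L) {n : ℕ}
    (hn : Odd n) (hL : L.index = 2 * n) : ∃ τ : E →* ℤˣ, τ z = -1 := by
  classical
  have hfi : L.FiniteIndex := ⟨by rw [hL]; have := hn.pos; omega⟩
  let _ : Fintype (E ⧸ L) := Fintype.ofFinite _
  refine ⟨Equiv.Perm.sign.comp (MulAction.toPermHom E (E ⧸ L)), ?_⟩
  have hfix : Fintype.card (Function.fixedPoints (MulAction.toPermHom E (E ⧸ L) z)) = 0 := by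
    rw [Fintype.card_eq_zero_iff]
    refine ⟨fun ⟨x, hx⟩ ↦ ?_⟩
    induction x using QuotientGroup.induction_on with
    | H g =>
      have hx' : ((z * g : E) : E ⧸ L) = (g : E ⧸ L) := hx
      rw [QuotientGroup.eq, ← Subgroup.mem_center_iff.1 hz g] at hx'
      apply hzL
      have h2 : (g * z)⁻¹ * g = z⁻¹ := by group
      rw [h2] at hx'
      simpa using L.inv_mem hx'
  have hcard : Fintype.card (E ⧸ L) = 2 * n := by
    rw [← hL, Subgroup.index, Nat.card_eq_fintype_card]
  have h2 : MulAction.toPermHom E (E ⧸ L) z ^ 2 = 1 := by rw [← map_pow, hz2, map_one]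
  rw [MonoidHom.comp_apply, Equiv.Perm.sign_of_pow_two_eq_one h2, hfix, hcard]
  simpa using hn.neg_one_pow

/-- The number of involutions of a group of even order is odd. -/
theorem odd_ncard_involutions {G : Type*} [Group G] [Finite G] (hG : Even (Nat.card G)) :
    Odd {g : G | g ^ 2 = 1 ∧ g ≠ 1}.ncard := by
  classical
  let _ : Fintype G := Fintype.ofFinite _
  -- Inversion is a permutation of order dividing two whose fixed points are `1` and the
  -- involutions; count modulo 2.
  let f : Function.End G := fun g ↦ g⁻¹
  have hf : f ^ 2 ^ 1 = 1 := by
    refine funext fun g ↦ ?_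
    change (g⁻¹)⁻¹ = g
    simp
  have := Equiv.Perm.card_fixedPoints_modEq (p := 2) hf
  have hfix : Function.fixedPoints f = insert 1 {g : G | g ^ 2 = 1 ∧ g ≠ 1} := by
    ext g
    change g⁻¹ = g ↔ _
    rw [Set.mem_insert_iff, Set.mem_ofPred_eq, inv_eq_iff_mul_eq_one, sq]
    by_cases h : g = 1 <;> simp [h]
  rw [← Nat.card_eq_fintype_card, ← Nat.card_eq_fintype_card, Nat.card_coe_set_eq, hfix,
    Set.ncard_insert_of_notMem (by simp)] at this
  rw [Nat.ModEq, Nat.even_iff.1 hG] at this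
  rw [Nat.odd_iff]
  omega

/-- If all involutions are conjugate, then centralizers of involutions have odd index. -/
theorem odd_index_centralizer_of_isConj {G : Type*} [Group G] [Finite G] {c : G}
    (hc : c ^ 2 = 1) (hc1 : c ≠ 1) (h : ∀ g : G, g ^ 2 = 1 → g ≠ 1 → IsConj c g) :
    Odd (Subgroup.centralizer {c}).index := by
  have hG : Even (Nat.card G) := by
    rw [even_iff_two_dvd, ← orderOf_eq_prime hc hc1]
    exact orderOf_dvd_natCard c
  have horb : MulAction.orbit (ConjAct G) c = {g : G | g ^ 2 = 1 ∧ g ≠ 1} := by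
    ext g
    rw [ConjAct.mem_orbit_conjAct]
    refine ⟨fun hg ↦ ?_, fun hg ↦ (h g hg.1 hg.2).symm⟩
    obtain ⟨x, rfl⟩ := isConj_iff.1 hg.symm
    exact ⟨by rw [conj_pow, hc]; simp, by simpa using hc1⟩
  have h1 : (Subgroup.centralizer {c}).index = (MulAction.stabilizer (ConjAct G) c).index := by
    rw [Subgroup.centralizer_eq_comap_stabilizer]
    exact Subgroup.index_comap_of_surjective _ ConjAct.toConjAct.surjective
  rw [h1, MulAction.index_stabilizer, horb]
  exact odd_ncard_involutions hG

/-- If every involution of a quotient by a central subgroup of order two lifts to an involution,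
then a subgroup of dihedral type of the quotient lifts isomorphically. -/
theorem exists_subgroup_index_eq_of_dihedral {E G : Type*} [Group E] [Group G] [Finite E]
    (π : E →* G) (hπ : Function.Surjective π) {z : E} (hz1 : z ≠ 1)
    (hker : ∀ e, π e = 1 ↔ e = 1 ∨ e = z) (hlift : ∀ e, π e ^ 2 = 1 → π e ≠ 1 → e ^ 2 = 1)
    (D : Subgroup G) {r s : G} (hD : ∀ d, d ∈ D ↔ ∃ i : ℤ, d = r ^ i ∨ d = s * r ^ i)
    (hs : s ^ 2 = 1) (hsr : (s * r) ^ 2 = 1) (hsn : s ∉ Subgroup.zpowers r)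
    (hr : Even (orderOf r)) :
    ∃ L : Subgroup E, z ∉ L ∧ L.index = 2 * D.index := by
  have : Finite G := Finite.of_surjective _ hπ
  obtain ⟨a, rfl⟩ := hπ r
  obtain ⟨b, rfl⟩ := hπ s
  have hne (i : ℤ) : π (b * a ^ i) ≠ 1 := fun h ↦ hsn <| by
    rw [map_mul, map_zpow, mul_eq_one_iff_eq_inv] at h
    rw [h]
    exact inv_mem (Subgroup.zpow_mem_zpowers _ _)
  have hb : b * b = 1 := by
    rw [← sq]
    exact hlift b hs (by simpa using hne 0)
  have hba : b * a * (b * a) = 1 := by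
    rw [← sq]
    exact hlift (b * a) (by rwa [map_mul]) (by simpa using hne 1)
  have hconj : b * a * b⁻¹ = a⁻¹ := by
    rw [eq_inv_iff_mul_eq_one, inv_eq_of_mul_eq_one_left hb]
    simpa [mul_assoc] using hba
  have hconj' (i : ℤ) : b * a ^ i = a ^ (-i) * b := by
    rw [zpow_neg, ← inv_zpow, ← hconj, conj_zpow]
    group
  -- For `r` of order `2k`, `r ^ k` is an involution, so its lift `a ^ k` squares to 1.
  have ha : a ^ orderOf (π a) = 1 := by
    obtain ⟨k, hk⟩ := hr
    have hpos := orderOf_pos (π a)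
    rw [hk, ← two_mul, mul_comm, pow_mul]
    apply hlift
    · rw [map_pow, ← pow_mul, mul_comm, two_mul, ← hk, pow_orderOf_eq_one]
    · rw [map_pow]
      exact pow_ne_one_of_lt_orderOf (by omega) (by omega)
  let L : Subgroup E :=
    { carrier := {x | ∃ i : ℤ, x = a ^ i ∨ x = b * a ^ i}
      one_mem' := ⟨0, Or.inl (by simp)⟩
      mul_mem' := by
        rintro _ _ ⟨i, rfl | rfl⟩ ⟨j, rfl | rfl⟩
        · exact ⟨i + j, Or.inl (zpow_add _ _ _).symm⟩
        · refine ⟨-i + j, Or.inr ?_⟩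
          rw [← mul_assoc, zpow_add, ← mul_assoc, hconj', neg_neg]
        · exact ⟨i + j, Or.inr (by rw [zpow_add, mul_assoc])⟩
        · refine ⟨-i + j, Or.inl ?_⟩
          rw [hconj', zpow_add, mul_assoc, ← mul_assoc b, hb, one_mul]
      inv_mem' := by
        rintro _ ⟨i, rfl | rfl⟩
        · exact ⟨-i, Or.inl (zpow_neg _ _).symm⟩
        · refine ⟨i, Or.inr ?_⟩
          rw [mul_inv_rev, ← zpow_neg, inv_eq_of_mul_eq_one_left hb, ← hconj'] }
  have hinj : ∀ x ∈ L, π x = 1 → x = 1 := by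
    rintro _ ⟨i, rfl | rfl⟩ h
    · rw [map_zpow, ← orderOf_dvd_iff_zpow_eq_one] at h
      obtain ⟨j, rfl⟩ := h
      rw [zpow_mul, zpow_natCast, ha, one_zpow]
    · exact absurd h (hne i)
  refine ⟨L, fun hzL ↦ hz1 (hinj z hzL ((hker z).2 (Or.inr rfl))), ?_⟩
  have hmap : (π '' L : Set G) = D := by
    ext d
    rw [SetLike.mem_coe, hD]
    constructor
    · rintro ⟨_, ⟨i, rfl | rfl⟩, rfl⟩
      · exact ⟨i, Or.inl (map_zpow _ _ _)⟩
      · exact ⟨i, Or.inr (by rw [map_mul, map_zpow])⟩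
    · rintro ⟨i, rfl | rfl⟩
      · exact ⟨a ^ i, ⟨i, Or.inl rfl⟩, map_zpow _ _ _⟩
      · exact ⟨b * a ^ i, ⟨i, Or.inr rfl⟩, by rw [map_mul, map_zpow]⟩
  have hLD : Nat.card D = Nat.card L := by
    have h1 : Set.InjOn π L := fun x hx y hy hxy ↦ by
      rw [← mul_inv_eq_one]
      exact hinj _ (L.mul_mem hx (L.inv_mem hy)) (by rw [map_mul, map_inv, hxy, mul_inv_cancel])
    have h2 := Nat.card_image_of_injOn h1
    rw [hmap] at h2
    exact h2
  have hEG : Nat.card E = 2 * Nat.card G := by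
    have hk : Nat.card π.ker = 2 := by
      have : (π.ker : Set E) = {1, z} := by
        ext e
        rw [SetLike.mem_coe, MonoidHom.mem_ker, hker]
        rfl
      rw [← SetLike.coe_sort_coe, this, Nat.card_coe_set_eq, Set.ncard_pair hz1.symm]
    rw [← π.ker.card_mul_index, hk, Subgroup.index_ker, MonoidHom.range_eq_top.2 hπ,
      Subgroup.card_top]
  have h1 := L.card_mul_index
  rw [hEG, ← D.card_mul_index, hLD, ← mul_assoc, mul_comm 2, mul_assoc] at h1
  exact Nat.eq_of_mul_eq_mul_left Nat.card_pos h1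

end GroupTheory

/-! ### Extensions from cocycles, and the splitting criterion -/

section Extension

/-- The central extension of `G` by `A` attached to a function `G × G → A`: pairs with
multiplication twisted by the function. -/
@[ext]
structure TwistedProduct {G A : Type*} (f : G × G → A) where
  /-- The component in the kernel. -/
  fst : A
  /-- The component in the quotient. -/
  snd : G

namespace TwistedProduct

variable {G A : Type*} [Group G] [AddCommGroup A] {f : G × G → A}

instance : Mul (TwistedProduct f) := ⟨fun x y ↦ ⟨x.1 + y.1 + f (x.2, y.2), x.2 * y.2⟩⟩

theorem mk_mul_mk (a b : A) (g h : G) :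
    (⟨a, g⟩ * ⟨b, h⟩ : TwistedProduct f) = ⟨a + b + f (g, h), g * h⟩ := rfl

/-- The group structure on a twisted product given by a 2-cocycle. -/
abbrev group (hf : ∀ g h j : G, f (g * h, j) + f (g, h) = f (h, j) + f (g, h * j)) :
    Group (TwistedProduct f) :=
  -- The cocycle is not assumed normalized, hence the correction by `f (1, 1)`.
  letI : One (TwistedProduct f) := ⟨⟨-f (1, 1), 1⟩⟩
  letI : Inv (TwistedProduct f) := ⟨fun x ↦ ⟨-x.1 - f (x.2⁻¹, x.2) - f (1, 1), x.2⁻¹⟩⟩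
  Group.ofLeftAxioms
    (by
      rintro ⟨a, g⟩ ⟨b, h⟩ ⟨c, j⟩
      simp only [mk_mul_mk, mul_assoc, mk.injEq, and_true]
      have := hf g h j
      calc a + b + f (g, h) + c + f (g * h, j) = a + b + c + (f (g * h, j) + f (g, h)) := by abel
        _ = _ := by rw [this]; abel)
    (by
      rintro ⟨a, g⟩
      change (⟨-f (1, 1) + a + f (1, g), 1 * g⟩ : TwistedProduct f) = _
      have := hf 1 1 g
      simp only [one_mul, add_right_inj] at this
      simp [← this])
    (by
      rintro ⟨a, g⟩
      change (⟨-a - f (g⁻¹, g) - f (1, 1) + a + f (g⁻¹, g), g⁻¹ * g⟩ : TwistedProduct f) =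
        ⟨-f (1, 1), 1⟩
      simp only [inv_mul_cancel, mk.injEq, and_true]
      abel)

end TwistedProduct

/-- A 2-cocycle with values in `ZMod 2` is a coboundary if its restriction to a subgroup of
dihedral type and odd index in a finite group with one class of involutions is trivial; this is
detected by the squares of the lifts of an involution. -/
theorem exists_eq_coboundary_of_dihedral {G : Type*} [Group G] [Finite G] {c : G}
    (hconj : ∀ g : G, g ^ 2 = 1 → g ≠ 1 → IsConj c g)
    {D : Subgroup G} (hDodd : Odd D.index) {r s : G}
    (hD : ∀ d, d ∈ D ↔ ∃ i : ℤ, d = r ^ i ∨ d = s * r ^ i)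
    (hs : s ^ 2 = 1) (hsr : (s * r) ^ 2 = 1) (hsn : s ∉ Subgroup.zpowers r)
    (hr : Even (orderOf r)) (f : G × G → ZMod 2)
    (hf : ∀ g h j : G, f (g * h, j) + f (g, h) = f (h, j) + f (g, h * j))
    (hfc : f (c, c) + f (1, 1) = 0) :
    ∃ x : G → ZMod 2, ∀ g h, f (g, h) = x h - x (g * h) + x g := by
  classical
  let _ : Group (TwistedProduct f) := TwistedProduct.group hf
  have hone : (1 : TwistedProduct f) = ⟨-f (1, 1), 1⟩ := rfl
  have hf1 (g : G) : f (1, g) = f (1, 1) := by simpa using (hf 1 1 g).symm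
  have hf2 (g : G) : f (g, 1) = f (1, 1) := by simpa using hf g 1 1
  have : Finite (TwistedProduct f) :=
    Finite.of_injective (fun x ↦ (x.1, x.2)) fun x y h ↦ by
      simp only [Prod.mk.injEq] at h
      exact TwistedProduct.ext h.1 h.2
  have hc : c ^ 2 = 1 := by
    obtain ⟨x, hx⟩ := isConj_iff.1 (hconj s hs fun h ↦ hsn (h ▸ one_mem _))
    have h2 : x * c ^ 2 * x⁻¹ = 1 := by rw [← conj_pow, hx, hs]
    simpa using h2
  let π : TwistedProduct f →* G :=
    { toFun := TwistedProduct.snd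
      map_one' := rfl
      map_mul' := fun _ _ ↦ rfl }
  have hπ : Function.Surjective π := fun g ↦ ⟨⟨0, g⟩, rfl⟩
  let z : TwistedProduct f := ⟨1 - f (1, 1), 1⟩
  have two : ∀ a : ZMod 2, a = 0 ∨ a = 1 := by decide
  have two_add : ∀ a : ZMod 2, a + a = 0 := by decide
  have hz1 : z ≠ 1 := fun h ↦ by
    have h' : 1 - f (1, 1) = -f (1, 1) := congrArg TwistedProduct.fst h
    rw [sub_eq_add_neg, add_eq_right] at h'
    exact one_ne_zero h'
  have hz2 : z ^ 2 = 1 := by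
    rw [sq]
    simp only [z, hone, TwistedProduct.mk_mul_mk, TwistedProduct.mk.injEq, mul_one, and_true]
    rw [two_add]
    generalize f (1, 1) = a
    revert a
    decide
  have hzc : z ∈ Subgroup.center (TwistedProduct f) := by
    rw [Subgroup.mem_center_iff]
    rintro ⟨a, g⟩
    simp [z, TwistedProduct.mk_mul_mk, hf1, hf2, add_comm]
  have hker (e) : π e = 1 ↔ e = 1 ∨ e = z := by
    obtain ⟨a, g⟩ := e
    change g = 1 ↔ _
    simp only [hone, z, TwistedProduct.mk.injEq, ← or_and_right]
    rw [iff_and_self]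
    intro _
    generalize f (1, 1) = b
    revert a b
    decide
  have hcsq (a : ZMod 2) : (⟨a, c⟩ : TwistedProduct f) ^ 2 = 1 := by
    rw [sq, TwistedProduct.mk_mul_mk, hone, two_add, zero_add, ← sq, hc,
      eq_neg_of_add_eq_zero_left hfc]
  have hlift (e) (h2 : π e ^ 2 = 1) (h1 : π e ≠ 1) : e ^ 2 = 1 := by
    obtain ⟨g, hg⟩ := isConj_iff.1 (hconj _ h2 h1)
    obtain ⟨w, rfl⟩ := hπ g
    have hw : π (w⁻¹ * e * w) = c := by
      rw [map_mul, map_mul, ← hg, map_inv]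
      group
    have h3 : (w⁻¹ * e * w) ^ 2 = 1 := by
      have := hcsq (w⁻¹ * e * w).1
      rwa [← hw] at this
    have h4 : (w⁻¹ * e * w) ^ 2 = w⁻¹ * e ^ 2 * w := by simp [sq, mul_assoc]
    rw [h4, mul_assoc, inv_mul_eq_one] at h3
    exact (right_eq_mul.1 h3)
  obtain ⟨L, hzL, hL⟩ :=
    exists_subgroup_index_eq_of_dihedral π hπ hz1 hker hlift D hD hs hsr hsn hr
  obtain ⟨τ, hτ⟩ := exists_monoidHom_units_int_eq_neg_one hzc hz2 L hzL hDodd hL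
  -- The cochain is `τ` on the section `g ↦ ⟨0, g⟩`, written additively; since `τ z = -1`, its
  -- coboundary is `f`.
  refine ⟨fun g ↦ if τ ⟨0, g⟩ = 1 then 0 else 1, fun g h ↦ ?_⟩
  have hmul : τ ⟨0, g⟩ * τ ⟨0, h⟩ = (if f (g, h) = 0 then 1 else -1) * τ ⟨0, g * h⟩ := by
    rw [← map_mul, TwistedProduct.mk_mul_mk]
    split_ifs with h0
    · simp [h0]
    · rw [← hτ, ← map_mul, (two _).resolve_left h0]
      simp [z, TwistedProduct.mk_mul_mk, hf1]
  revert hmul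
  rcases two (f (g, h)) with h0 | h0 <;>
  rcases Int.units_eq_one_or (τ ⟨0, g⟩) with h1 | h1 <;>
  rcases Int.units_eq_one_or (τ ⟨0, h⟩) with h2 | h2 <;>
  rcases Int.units_eq_one_or (τ ⟨0, g * h⟩) with h3 | h3 <;>
  simp [h0, h1, h2, h3] <;> decide

end Extension

/-! ### Square roots of `-1` in `SL₂` and the centralizer of one of them -/

section SpecialLinear

open Matrix

/-- Every element of a finite field of odd characteristic is a sum of two squares. -/
theorem FiniteField.exists_sq_add_sq_eq {F : Type*} [Field F] [Finite F]
    (hF : Odd (Nat.card F)) (c : F) : ∃ a b : F, a ^ 2 + b ^ 2 = c := by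
  let _ : Fintype F := Fintype.ofFinite F
  obtain ⟨a, b, h⟩ := FiniteField.exists_root_sum_quadratic (R := F)
    (f := Polynomial.X ^ 2) (g := Polynomial.X ^ 2 - Polynomial.C c)
    (Polynomial.degree_X_pow 2) (Polynomial.degree_X_pow_sub_C two_pos c)
    (by rw [← Nat.card_eq_fintype_card]; exact Nat.odd_iff.1 hF)
  exact ⟨a, b, by simpa [← add_sub_assoc, sub_eq_zero] using h⟩

theorem FiniteField.two_ne_zero_of_odd_card {F : Type*} [Field F] [Finite F]
    (hF : Odd (Nat.card F)) : (2 : F) ≠ 0 := by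
  let _ : Fintype F := Fintype.ofFinite F
  refine Ring.two_ne_zero fun h ↦ ?_
  rw [FiniteField.even_card_iff_char_two, ← Nat.card_eq_fintype_card] at h
  rw [Nat.odd_iff] at hF
  omega

namespace Matrix.SpecialLinearGroup

variable {F : Type*} [Field F]

theorem ext_fin_two_iff {A B : SL(2, F)} :
    A = B ↔ A 0 0 = B 0 0 ∧ A 0 1 = B 0 1 ∧ A 1 0 = B 1 0 ∧ A 1 1 = B 1 1 := by
  constructor
  · rintro rfl
    simp
  · rintro ⟨h1, h2, h3, h4⟩
    ext i j
    fin_cases i <;> fin_cases j <;> assumption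

theorem det_fin_two_eq_one (A : SL(2, F)) : A 0 0 * A 1 1 - A 0 1 * A 1 0 = 1 := by
  rw [← Matrix.det_fin_two, A.det_coe]

theorem mul_apply_fin_two (A B : SL(2, F)) (i j : Fin 2) :
    (A * B) i j = A i 0 * B 0 j + A i 1 * B 1 j := by
  rw [coe_mul, Matrix.mul_apply, Fin.sum_univ_two]

theorem neg_apply_fin_two (A : SL(2, F)) (i j : Fin 2) : (-A) i j = -A i j := by
  simp

theorem mem_center_fin_two_iff {A : SL(2, F)} :
    A ∈ Subgroup.center SL(2, F) ↔ A = 1 ∨ A = -1 := by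
  rw [mem_center_iff]
  constructor
  · rintro ⟨r, hr, hA⟩
    rw [Fintype.card_fin, sq_eq_one_iff] at hr
    rcases hr with rfl | rfl
    · left
      apply Subtype.ext
      simp [← hA]
    · right
      apply Subtype.ext
      rw [← hA, map_neg, map_one]
      rfl
  · rintro (rfl | rfl)
    · exact ⟨1, by simp, by simp⟩
    · exact ⟨-1, by simp, by rw [map_neg, map_one]; rfl⟩

theorem neg_ne_self (h2 : (2 : F) ≠ 0) (A : SL(2, F)) : -A ≠ A := by
  intro h
  obtain ⟨ha, hb, hc, hd⟩ := ext_fin_two_iff.1 h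
  simp only [neg_apply_fin_two, neg_eq_iff_add_eq_zero, ← two_mul, mul_eq_zero, h2,
    false_or] at ha hb hc hd
  have := A.det_fin_two_eq_one
  simp [ha, hb] at this

theorem eq_one_or_eq_neg_one_of_sq_eq_one (h2 : (2 : F) ≠ 0) {A : SL(2, F)} (hA : A * A = 1) :
    A = 1 ∨ A = -1 := by
  obtain ⟨ha, hb, hc, hd⟩ := ext_fin_two_iff.1 hA
  simp only [mul_apply_fin_two, coe_one, one_apply_eq, ne_eq, zero_ne_one, one_ne_zero,
    not_false_eq_true, one_apply_ne] at ha hb hc hd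
  have hdet := A.det_fin_two_eq_one
  have ht : A 0 0 + A 1 1 ≠ 0 := fun ht ↦ h2 (by
    linear_combination (-1 : F) * ha - hdet + A 0 0 * ht)
  have hb0 : A 0 1 = 0 := (mul_eq_zero.1 (by linear_combination hb)).resolve_right ht
  have hc0 : A 1 0 = 0 := (mul_eq_zero.1 (by linear_combination hc)).resolve_right ht
  have had : A 0 0 = A 1 1 := by
    rw [← sub_eq_zero]
    refine (mul_eq_zero.1 (?_ : _ * (A 0 0 + A 1 1) = 0)).resolve_right ht
    linear_combination ha - hd
  rw [hb0, zero_mul, add_zero] at ha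
  rcases mul_self_eq_one_iff.1 ha with h | h
  · left
    rw [ext_fin_two_iff]
    simp [← had, h, hb0, hc0]
  · right
    rw [ext_fin_two_iff]
    simp [← had, h, hb0, hc0]

/-- By Cayley–Hamilton, `A² = tA - 1` with `t` the trace, so the condition is `tA = 0`, that is `t =
0`. -/
theorem mul_self_eq_neg_one_iff {A : SL(2, F)} :
    A * A = -1 ↔ A 1 1 = -A 0 0 := by
  have hdet := A.det_fin_two_eq_one
  rw [ext_fin_two_iff]
  simp only [mul_apply_fin_two, coe_neg, coe_one, neg_apply, one_apply_eq, ne_eq, zero_ne_one,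
    one_ne_zero, not_false_eq_true, one_apply_ne, neg_zero]
  constructor
  · rintro ⟨ha, hb, hc, hd⟩
    rw [← add_eq_zero_iff_eq_neg]
    by_contra ht
    have hb0 : A 0 1 = 0 := (mul_eq_zero.1 (by linear_combination hb)).resolve_right ht
    have h0 : A 0 0 = 0 := (mul_eq_zero.1 (by linear_combination ha + hdet)).resolve_right ht
    simp [hb0, h0] at hdet
  · intro h
    rw [h] at hdet ⊢
    refine ⟨?_, ?_, ?_, ?_⟩ <;> first | ring1 | linear_combination (-1 : F) * hdet

/-- The rotation of order four. -/
def quarterTurn (F : Type*) [Field F] : SL(2, F) := ⟨!![0, -1; 1, 0], by simp [det_fin_two]⟩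

theorem quarterTurn_mul_self : quarterTurn F * quarterTurn F = -1 := by
  rw [mul_self_eq_neg_one_iff]
  simp [quarterTurn]

theorem commute_quarterTurn_iff {A : SL(2, F)} :
    A * quarterTurn F = quarterTurn F * A ↔ A 1 1 = A 0 0 ∧ A 0 1 = -A 1 0 := by
  rw [ext_fin_two_iff]
  simp only [mul_apply_fin_two]
  simp [quarterTurn]
  grind

theorem anticommute_quarterTurn_iff {A : SL(2, F)} :
    A * quarterTurn F = -(quarterTurn F * A) ↔ A 1 1 = -A 0 0 ∧ A 0 1 = A 1 0 := by
  rw [ext_fin_two_iff]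
  simp only [neg_apply_fin_two, mul_apply_fin_two]
  simp [quarterTurn]
  grind

/-- Over a finite field of odd order, square roots of `-1` in `SL₂` are conjugate. -/
theorem isConj_quarterTurn [Finite F] (hF : Odd (Nat.card F)) {A : SL(2, F)}
    (hA : A * A = -1) : IsConj (quarterTurn F) A := by
  have h2 := FiniteField.two_ne_zero_of_odd_card hF
  rw [mul_self_eq_neg_one_iff] at hA
  have hdet := A.det_fin_two_eq_one
  rw [hA] at hdet
  -- The conjugator has columns `v = (x, y)` and `A v`, so `det (v, A v) = 1` is needed. If `A 1 0 ≠
  -- 0`, completing the square turns this into `u² + y² = A 1 0`, where `u = A 1 0 * x - A 0 0 * y`.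
  obtain ⟨x, y, hxy⟩ : ∃ x y : F,
      x * (A 1 0 * x - A 0 0 * y) - y * (A 0 0 * x + A 0 1 * y) = 1 := by
    by_cases hc : A 1 0 = 0
    · have ha : A 0 0 ≠ 0 := fun ha ↦ by simp [hc, ha] at hdet
      refine ⟨(-1 - A 0 1) / (2 * A 0 0), 1, ?_⟩
      rw [hc]
      field_simp
      ring
    · obtain ⟨u, y, huy⟩ := FiniteField.exists_sq_add_sq_eq hF (A 1 0)
      refine ⟨(u + A 0 0 * y) / A 1 0, y, ?_⟩
      field_simp
      linear_combination huy + y ^ 2 * hdet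
  rw [isConj_iff]
  let P : SL(2, F) :=
    ⟨!![x, A 0 0 * x + A 0 1 * y; y, A 1 0 * x - A 0 0 * y], by
      rw [det_fin_two_of]
      linear_combination hxy⟩
  refine ⟨P, ?_⟩
  rw [mul_inv_eq_iff_eq_mul, ext_fin_two_iff]
  simp only [mul_apply_fin_two]
  simp [P, quarterTurn, hA]
  constructor
  · linear_combination x * hdet
  constructor
  · ring
  · linear_combination y * hdet

/-- The centralizer of the rotation of order four is cyclic. -/
theorem isCyclic_centralizer_quarterTurn [Finite F] (h2 : (2 : F) ≠ 0) :
    IsCyclic (Subgroup.centralizer {quarterTurn F}) := by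
  obtain ⟨i, hi⟩ := IsAlgClosed.exists_pow_nat_eq (k := AlgebraicClosure F) (-1) two_pos
  let φ : F →+* AlgebraicClosure F := algebraMap F _
  have hφ2 : (2 : AlgebraicClosure F) ≠ 0 := by
    rw [← map_ofNat φ 2]
    exact (map_ne_zero φ).2 h2
  have key (A : Subgroup.centralizer {quarterTurn F}) :
      A.1 1 1 = A.1 0 0 ∧ A.1 0 1 = -A.1 1 0 :=
    commute_quarterTurn_iff.1 (Subgroup.mem_centralizer_singleton_iff.1 A.2)
  have : Finite (SL(2, F)) := Subtype.finite
  -- The centralizer consists of matrices `[[a, -b], [b, a]]`, which multiply like `a + ib`; a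
  -- finite group embedded in a field is cyclic.
  let ψ : Subgroup.centralizer {quarterTurn F} →* AlgebraicClosure F :=
    { toFun := fun A ↦ φ (A.1 0 0) + i * φ (A.1 1 0)
      map_one' := by simp
      map_mul' := fun A B ↦ by
        simp only [Subgroup.coe_mul, mul_apply_fin_two, map_add, map_mul, (key A).1, (key A).2,
          map_neg]
        linear_combination (-φ (A.1 1 0) * φ (B.1 1 0)) * hi }
  have hψ (A : Subgroup.centralizer {quarterTurn F}) :
      ψ A * (φ (A.1 0 0) - i * φ (A.1 1 0)) = 1 := by
    have hdet := congrArg φ A.1.det_fin_two_eq_one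
    rw [(key A).1, (key A).2] at hdet
    simp only [map_sub, map_mul, map_neg, map_one] at hdet
    change (φ (A.1 0 0) + i * φ (A.1 1 0)) * _ = 1
    linear_combination hdet - φ (A.1 1 0) ^ 2 * hi
  refine isCyclic_of_injective_ringHom ψ fun A B hAB ↦ ?_
  have h1 : φ (A.1 0 0) + i * φ (A.1 1 0) = φ (B.1 0 0) + i * φ (B.1 1 0) := hAB
  have h3 : φ (A.1 0 0) - i * φ (A.1 1 0) = φ (B.1 0 0) - i * φ (B.1 1 0) := by
    have hA := hψ A
    rw [hAB] at hA
    exact mul_left_cancel₀ (left_ne_zero_of_mul_eq_one hA) (hA.trans (hψ B).symm)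
  have hi0 : i ≠ 0 := fun h ↦ by simp [h] at hi
  have h00 : A.1 0 0 = B.1 0 0 := φ.injective <| mul_left_cancel₀ hφ2 <| by
    linear_combination h1 + h3
  have h10 : A.1 1 0 = B.1 1 0 := φ.injective <| mul_left_cancel₀ (mul_ne_zero hφ2 hi0) <| by
    linear_combination h1 - h3
  apply Subtype.ext
  rw [ext_fin_two_iff, (key A).1, (key A).2, (key B).1, (key B).2]
  simp [h00, h10]

end Matrix.SpecialLinearGroup

end SpecialLinear

/-! ### The invariant on cohomology and the structure of `PSL₂` -/

section Main

open Matrix Matrix.SpecialLinearGroup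

/-- If the square of the lifts of an involution is the only obstruction to splitting a central
extension by `ZMod 2`, and this obstruction is nontrivial for some extension, then the second
cohomology is `ZMod 2`. -/
theorem nonempty_groupCohomology_two_addEquiv_zmod_two {G : Type} [Group G] {c : G}
    (hc : c ^ 2 = 1)
    (hinj : ∀ f : G × G → ZMod 2,
      (∀ g h j : G, f (g * h, j) + f (g, h) = f (h, j) + f (g, h * j)) →
      f (c, c) + f (1, 1) = 0 → ∃ x : G → ZMod 2, ∀ g h, f (g, h) = x h - x (g * h) + x g)
    (hsurj : ∃ f : G × G → ZMod 2,
      (∀ g h j : G, f (g * h, j) + f (g, h) = f (h, j) + f (g, h * j)) ∧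
      f (c, c) + f (1, 1) = 1) :
    Nonempty (groupCohomology (Rep.trivial ℤ G (ZMod 2)) 2 ≃+ ZMod 2) := by
  let A := Rep.trivial ℤ G (ZMod 2)
  let ev : groupCohomology.cocycles₂ A →+ ZMod 2 :=
    { toFun := fun f ↦ f.1 (c, c) + f.1 (1, 1)
      map_zero' := add_zero _
      map_add' := fun f g ↦ add_add_add_comm (f.1 (c, c)) (g.1 (c, c)) (f.1 (1, 1)) (g.1 (1, 1)) }
  have hev : Function.Surjective ev := by
    obtain ⟨f, hf, hf1⟩ := hsurj
    intro a
    obtain rfl | rfl : a = 0 ∨ a = 1 := by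
      revert a
      decide
    · exact ⟨0, map_zero ev⟩
    · exact ⟨⟨f, (groupCohomology.mem_cocycles₂_iff (A := A) f).2 hf⟩, hf1⟩
  let p : groupCohomology.cocycles₂ A →+ groupCohomology A 2 :=
    (groupCohomology.H2π A).hom.toAddMonoidHom
  have hp : Function.Surjective p :=
    (ModuleCat.epi_iff_surjective (groupCohomology.H2π A)).1 inferInstance
  have hker : p.ker = ev.ker := by
    ext f
    rw [AddMonoidHom.mem_ker, AddMonoidHom.mem_ker]
    refine (groupCohomology.H2π_eq_zero_iff f).trans ⟨?_, fun h ↦ ?_⟩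
    · rintro ⟨x, hx⟩
      have h1 : f.1 (c, c) = x c - x (c * c) + x c := (congrFun hx (c, c)).symm
      have h2 : f.1 (1, 1) = x 1 - x (1 * 1) + x 1 := (congrFun hx (1, 1)).symm
      change (f.1 (c, c) : ZMod 2) + f.1 (1, 1) = 0
      rw [h1, h2, ← sq, hc, mul_one]
      have key : ∀ a b : ZMod 2, a - b + a + (b - b + b) = 0 := by decide
      exact key (x c) (x 1)
    · obtain ⟨x, hx⟩ := hinj f.1 ((groupCohomology.mem_cocycles₂_iff f.1).1 f.2) h
      exact ⟨x, funext fun g ↦ (hx g.1 g.2).symm⟩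
  exact ⟨(QuotientAddGroup.quotientKerEquivOfSurjective p hp).symm.trans
    ((QuotientAddGroup.quotientAddEquivOfEq hker).trans
      (QuotientAddGroup.quotientKerEquivOfSurjective ev hev))⟩

variable {F : Type*} [Field F]

theorem projectiveSpecialLinearGroup_mk_eq_one_iff {A : SL(2, F)} :
    (A : PSL(2, F)) = 1 ↔ A = 1 ∨ A = -1 := by
  rw [QuotientGroup.eq_one_iff, mem_center_fin_two_iff]

theorem projectiveSpecialLinearGroup_mk_eq_mk_iff {A B : SL(2, F)} :
    (A : PSL(2, F)) = B ↔ A = B ∨ A = -B := by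
  rw [← mul_inv_eq_one, ← QuotientGroup.mk_inv, ← QuotientGroup.mk_mul,
    projectiveSpecialLinearGroup_mk_eq_one_iff, mul_inv_eq_one, mul_inv_eq_iff_eq_mul,
    neg_one_mul]

theorem projectiveSpecialLinearGroup_mk_involution_iff (h2 : (2 : F) ≠ 0) {A : SL(2, F)} :
    (A : PSL(2, F)) ^ 2 = 1 ∧ (A : PSL(2, F)) ≠ 1 ↔ A * A = -1 := by
  rw [sq, ← QuotientGroup.mk_mul, projectiveSpecialLinearGroup_mk_eq_one_iff, ne_eq,
    projectiveSpecialLinearGroup_mk_eq_one_iff]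
  constructor
  · rintro ⟨h | h, h1⟩
    · exact absurd (eq_one_or_eq_neg_one_of_sq_eq_one h2 h) h1
    · exact h
  · intro h
    refine ⟨Or.inr h, ?_⟩
    rintro (rfl | rfl)
    · rw [one_mul] at h
      exact neg_ne_self h2 1 h.symm
    · rw [neg_mul_neg, one_mul] at h
      exact neg_ne_self h2 1 h.symm

/-- The extension is `SL₂` itself: `f` measures how far a set-theoretic section is from
multiplicative. -/
theorem exists_cocycle_projectiveSpecialLinearGroup (h2 : (2 : F) ≠ 0) :
    ∃ f : PSL(2, F) × PSL(2, F) → ZMod 2,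
      (∀ g h j, f (g * h, j) + f (g, h) = f (h, j) + f (g, h * j)) ∧
      f ((quarterTurn F : PSL(2, F)), (quarterTurn F : PSL(2, F))) + f (1, 1) = 1 := by
  classical
  let e : ZMod 2 → SL(2, F) := fun a ↦ if a = 0 then 1 else -1
  have two : ∀ a : ZMod 2, a = 0 ∨ a = 1 := by decide
  have two_add : (1 : ZMod 2) + 1 = 0 := by decide
  have he0 : e 0 = 1 := if_pos rfl
  have he1 : e 1 = -1 := if_neg one_ne_zero
  have he (a b) : e (a + b) = e a * e b := by
    rcases two a with rfl | rfl <;> rcases two b with rfl | rfl <;> simp [he0, he1, two_add]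
  have hcomm (a) (A : SL(2, F)) : e a * A = A * e a := by
    rcases two a with rfl | rfl <;> simp [he0, he1]
  have heinj : Function.Injective e := fun a b h ↦ by
    rcases two a with rfl | rfl <;> rcases two b with rfl | rfl
    · rfl
    · exact absurd (he1.symm.trans (h.symm.trans he0)) (neg_ne_self h2 1)
    · exact absurd (he1.symm.trans (h.trans he0)) (neg_ne_self h2 1)
    · rfl
  have hlift {A B : SL(2, F)} (h : (A : PSL(2, F)) = B) : ∃ a, A = e a * B := by
    rcases projectiveSpecialLinearGroup_mk_eq_mk_iff.1 h with h | h
    · exact ⟨0, by rw [he0, one_mul, h]⟩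
    · exact ⟨1, by rw [he1, neg_one_mul, h]⟩
  obtain ⟨s, hs⟩ : ∃ s : PSL(2, F) → SL(2, F), ∀ g, (s g : PSL(2, F)) = g :=
    ⟨Quotient.out, fun g ↦ QuotientGroup.out_eq' g⟩
  have hex (g : PSL(2, F) × PSL(2, F)) : ∃ a, s g.1 * s g.2 = e a * s (g.1 * g.2) :=
    hlift (by rw [QuotientGroup.mk_mul, hs, hs, hs])
  choose f hf using hex
  refine ⟨f, fun g h j ↦ ?_, ?_⟩
  · apply heinj
    rw [he, he]
    apply mul_right_cancel (b := s (g * h * j))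
    calc e (f (g * h, j)) * e (f (g, h)) * s (g * h * j)
        = e (f (g, h)) * (e (f (g * h, j)) * s (g * h * j)) := by rw [hcomm, mul_assoc]
      _ = s g * s h * s j := by rw [← hf (g * h, j), ← mul_assoc, ← hf (g, h)]
      _ = s g * (e (f (h, j)) * s (h * j)) := by rw [mul_assoc, ← hf (h, j)]
      _ = e (f (h, j)) * (s g * s (h * j)) := by rw [← mul_assoc, ← hcomm, mul_assoc]
      _ = _ := by rw [hf (g, h * j), mul_assoc, mul_assoc g h j]
  · obtain ⟨a, ha⟩ := hlift (hs (quarterTurn F : PSL(2, F)))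
    have hsq (b) : e b * e b = 1 := by
      rcases two b with rfl | rfl <;> simp [he0, he1]
    have h1 : s 1 = e (f (1, 1)) := by
      have := hf (1, 1)
      rw [mul_one] at this
      exact mul_right_cancel this
    have hc := hf ((quarterTurn F : PSL(2, F)), (quarterTurn F : PSL(2, F)))
    have hcc : (quarterTurn F : PSL(2, F)) * (quarterTurn F : PSL(2, F)) = 1 := by
      rw [← sq]
      exact ((projectiveSpecialLinearGroup_mk_involution_iff h2).2 quarterTurn_mul_self).1
    simp only [hcc] at hc
    rw [h1, ha, mul_assoc, ← mul_assoc _ (e a), ← hcomm a, mul_assoc, quarterTurn_mul_self,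
      ← mul_assoc, hsq, one_mul, ← he, ← he1] at hc
    exact (heinj hc).symm

/-- The centralizer of an involution in `PSL₂` over a finite field of odd order is of dihedral
type. -/
theorem exists_dihedral_centralizer_quarterTurn [Finite F] (hF : Odd (Nat.card F)) :
    ∃ r s : PSL(2, F),
      (∀ d, d ∈ Subgroup.centralizer {(quarterTurn F : PSL(2, F))} ↔
        ∃ i : ℤ, d = r ^ i ∨ d = s * r ^ i) ∧
      s ^ 2 = 1 ∧ (s * r) ^ 2 = 1 ∧ s ∉ Subgroup.zpowers r ∧ Even (orderOf r) := by
  have h2 := FiniteField.two_ne_zero_of_odd_card hF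
  have : Finite SL(2, F) := Subtype.finite
  obtain ⟨⟨R, hR⟩, hgen⟩ := isCyclic_centralizer_quarterTurn h2
  rw [Subgroup.mem_centralizer_singleton_iff] at hR
  have hgen' {A : SL(2, F)} (hA : A * quarterTurn F = quarterTurn F * A) :
      ∃ i : ℤ, R ^ i = A := by
    obtain ⟨i, hi⟩ := hgen ⟨A, Subgroup.mem_centralizer_singleton_iff.2 hA⟩
    exact ⟨i, congrArg Subtype.val hi⟩
  have hRpow (i : ℤ) : R ^ i * quarterTurn F = quarterTurn F * R ^ i :=
    Commute.zpow_left hR i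
  obtain ⟨u, v, huv⟩ := FiniteField.exists_sq_add_sq_eq hF (-1)
  -- `S` must anticommute with the quarter turn, hence be symmetric of trace zero; determinant one
  -- then reads `u² + v² = -1`.
  let S : SL(2, F) := ⟨!![u, v; v, -u], by rw [det_fin_two_of]; linear_combination -huv⟩
  have hS : S * quarterTurn F = -(quarterTurn F * S) :=
    anticommute_quarterTurn_iff.2 (by simp [S])
  have hsq {A : SL(2, F)} (hA : A * quarterTurn F = -(quarterTurn F * A)) : A * A = -1 :=
    mul_self_eq_neg_one_iff.2 (anticommute_quarterTurn_iff.1 hA).1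
  have hmk {A : SL(2, F)} (hA : A * A = -1) :=
    (projectiveSpecialLinearGroup_mk_involution_iff h2).2 hA
  have hSR : S * R * quarterTurn F = -(quarterTurn F * (S * R)) := by
    rw [mul_assoc, hR, ← mul_assoc, hS, neg_mul, mul_assoc]
  refine ⟨R, S, fun d ↦ ?_, (hmk (hsq hS)).1, (hmk (hsq hSR)).1, ?_, ?_⟩
  · obtain ⟨A, rfl⟩ := QuotientGroup.mk_surjective d
    rw [Subgroup.mem_centralizer_singleton_iff, ← QuotientGroup.mk_mul, ← QuotientGroup.mk_mul,
      projectiveSpecialLinearGroup_mk_eq_mk_iff]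
    simp only [← QuotientGroup.mk_zpow, ← QuotientGroup.mk_mul,
      projectiveSpecialLinearGroup_mk_eq_mk_iff]
    constructor
    · rintro (hA | hA)
      · obtain ⟨i, rfl⟩ := hgen' hA
        exact ⟨i, Or.inl (Or.inl rfl)⟩
      -- Two anticommuting factors give a commuting product, so `S * A` is a power of `R`.
      · have hSA : S * A * quarterTurn F = quarterTurn F * (S * A) := by
          rw [mul_assoc, hA, mul_neg, ← mul_assoc, hS, neg_mul, neg_neg, mul_assoc]
        obtain ⟨i, hi⟩ := hgen' hSA
        refine ⟨i, Or.inr (Or.inr ?_)⟩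
        rw [hi, ← mul_assoc, hsq hS, neg_one_mul, neg_neg]
    · rintro ⟨i, (rfl | rfl) | (rfl | rfl)⟩
      · exact Or.inl (hRpow i)
      · exact Or.inl (by rw [neg_mul, hRpow, mul_neg])
      · exact Or.inr (by rw [mul_assoc, hRpow, ← mul_assoc, hS, neg_mul, mul_assoc])
      · exact Or.inr (by
          rw [neg_mul, mul_assoc, hRpow, ← mul_assoc, hS, neg_mul, mul_assoc, mul_neg])
  · rintro ⟨i, hi⟩
    change (R : PSL(2, F)) ^ i = S at hi
    rw [← QuotientGroup.mk_zpow, projectiveSpecialLinearGroup_mk_eq_mk_iff] at hi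
    have hcomm : S * quarterTurn F = quarterTurn F * S := by
      rcases hi with hi | hi
      · rw [← hi, hRpow]
      · rw [← neg_eq_iff_eq_neg] at hi
        rw [← hi, neg_mul, hRpow, mul_neg]
    exact neg_ne_self h2 _ (hS.symm.trans hcomm)
  -- The quarter turn is a power of `R`, and its image has order two.
  · obtain ⟨i, hi⟩ := hgen' (A := quarterTurn F) rfl
    obtain ⟨hc, hc1⟩ := hmk (quarterTurn_mul_self (F := F))
    rw [even_iff_two_dvd]
    refine (orderOf_eq_prime hc hc1).symm.dvd.trans ?_
    rw [← hi, QuotientGroup.mk_zpow]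
    exact orderOf_dvd_of_mem_zpowers (Subgroup.zpow_mem_zpowers _ _)

end Main

theorem mainTheorem4 (q : ℕ) (hq : IsPrimePow q) (hodd : Odd q)
    (F : Type) [Field F] [Finite F] (hF : Nat.card F = q) :
    Nonempty (groupCohomology (Rep.trivial ℤ PSL(2, F) (ZMod 2)) 2 ≃+ ZMod 2) := by
  have hF' : Odd (Nat.card F) := hF ▸ hodd
  have h2 := FiniteField.two_ne_zero_of_odd_card hF'
  have : Finite SL(2, F) := Subtype.finite
  obtain ⟨hc, hc1⟩ := (projectiveSpecialLinearGroup_mk_involution_iff h2).2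
    (Matrix.SpecialLinearGroup.quarterTurn_mul_self (F := F))
  have hconj (g : PSL(2, F)) (hg : g ^ 2 = 1) (hg1 : g ≠ 1) :
      IsConj (Matrix.SpecialLinearGroup.quarterTurn F : PSL(2, F)) g := by
    obtain ⟨A, rfl⟩ := QuotientGroup.mk_surjective g
    exact (QuotientGroup.mk' (Subgroup.center SL(2, F))).map_isConj
      (Matrix.SpecialLinearGroup.isConj_quarterTurn hF'
        ((projectiveSpecialLinearGroup_mk_involution_iff h2).1 ⟨hg, hg1⟩))
  obtain ⟨r, s, hD, hs, hsr, hsn, hr⟩ := exists_dihedral_centralizer_quarterTurn hF'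
  exact nonempty_groupCohomology_two_addEquiv_zmod_two hc
    (exists_eq_coboundary_of_dihedral hconj (odd_index_centralizer_of_isConj hc hc1 hconj)
      hD hs hsr hsn hr)
    (exists_cocycle_projectiveSpecialLinearGroup h2)
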